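/- Let $\varphi:[0,\infty)\to\mathbb R$ be a function such that, for every $D\in\mathbb N$, the isotropic kernel $k_{\lim}(\mathbf x,\mathbf x')=\varphi(\Vert\mathbf x-\mathbf x'\Vert_2^2)$ is a mean-square continuous covariance function on $\mathbb R^D\times\mathbb R^D$. (A covariance function is a kernel $k$ all of whose finite Gram matrices are symmetric positive semidefinite; it is mean-square continuous if $k(\mathbf x,\mathbf x)-2k(\mathbf x,\mathbf x')+k(\mathbf x',\mathbf x')\to 0$ as $\mathbf x'\to\mathbf x$, for every $\mathbf x$.) Then there is a finite positive Borel measure $\mu$ on $[0,\infty)$ with $$\varphi(r)=\int \exp\left(-\tfrac12\, r\,\beta\right)\,d\mu(\beta)\qquad\text{for all } r\ge 0,$$ and, for every input dimension $D\in\mathbb N$ and every width $H_1\ge 1$, there is a 2-layer zero-mean Deep Gaussian process $f_2(\mathbf f_1(\cdot))$, with $\mathbf f_1:\mathbb R^D\to\mathbb R^{H_1}$ and $f_2:\mathbb R^{H_1}\to\mathbb R$, whose layers have the linear covariance $k_1$ and the stationary covariance $k_2$ given by $$k_1(\mathbf x,\mathbf x')=\mathbf x^\top\mathbf x',\qquad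 k_2(\mathbf z,\mathbf z')=\frac1{H_1}\sum_{j=1}^{H_1}\int\cos\left(\sqrt\beta\,(z_j-z'_j)\right)d\mu(\beta),$$ and whose prior covariance is $k_{\lim}$: for all $\mathbf x,\mathbf x'\in\mathbb R^D$, $f_2(\mathbf f_1(\mathbf x))$ is square integrable with mean zero, and $$\mathbb E\left[f_2(\mathbf f_1(\mathbf x))\,f_2(\mathbf f_1(\mathbf x'))\right]=\varphi(\Vert\mathbf x-\mathbf x'\Vert_2^2).$$ Here a 2-layer zero-mean Deep Gaussian process with layer covariances $k_1,k_2$ means that the $H_1$ coordinates of $\mathbf f_1$ are i.i.d. Gaussian processes $\mathrm{GP}(0,k_1)$, that $f_2\sim\mathrm{GP}(0,k_2)$, and that $f_2$ is independent of $\mathbf f_1$ and jointly measurable (precisely: $(\mathbf z,\omega)\mapsto f_2(\mathbf z)(\omega)$ is measurable for the product of the Borel $\sigma$-algebra and some $\sigma$-algebra of events independent of $\mathbf f_1$), so that $f_2(\mathbf f_1(\mathbf x))$ is a well-defined random variable. -/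

import Mathlib

open MeasureTheory ProbabilityTheory Filter Topology
open scoped NNReal

/-- A real function of two variables is a valid covariance function if all its Gram matrices
`[k (x i) (x j)]` on finitely many points are symmetric positive semidefinite. -/
def IsCovarianceFunction {T : Type*} (k : T → T → ℝ) : Prop :=
  ∀ (n : ℕ) (x : Fin n → T), (Matrix.of fun i j => k (x i) (x j)).PosSemidef

/-- Mean-square continuity, in terms of the covariance function: for a zero-mean process `g` with
covariance `k`, the quantity `k x x - 2 * k x x' + k x' x'` is `𝔼 |g x - g x'| ^ 2`. -/
def IsMeanSquareContinuous {T : Type*} [TopologicalSpace T] (k : T → T → ℝ) : Prop :=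
  ∀ x : T, Tendsto (fun x' => k x x - 2 * k x x' + k x' x') (𝓝 x) (𝓝 0)

/-- The isotropic kernel `(x, x') ↦ φ (‖x - x'‖²)` on `ℝ^D`. -/
noncomputable def isotropicKernel (φ : ℝ → ℝ) (D : ℕ) (x x' : EuclideanSpace ℝ (Fin D)) : ℝ :=
  φ (‖x - x'‖ ^ 2)

/-- The linear kernel `(x, x') ↦ xᵀ x'` on `ℝ^D`. -/
noncomputable def linearKernel (D : ℕ) (x x' : EuclideanSpace ℝ (Fin D)) : ℝ :=
  inner ℝ x x'

/-- The stationary kernel `(z, z') ↦ H⁻¹ ∑ⱼ ∫ cos (√β (zⱼ - z'ⱼ)) dμ(β)` on `ℝ^H`. -/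
noncomputable def additiveSpectralKernel (μ : Measure ℝ≥0) (H : ℕ)
    (z z' : EuclideanSpace ℝ (Fin H)) : ℝ :=
  (H : ℝ)⁻¹ * ∑ j : Fin H, ∫ β : ℝ≥0, Real.cos (Real.sqrt (β : ℝ) * (z j - z' j)) ∂μ

/-- `X ∼ GP(0, k)` under `P`. -/
structure IsZeroMeanGP {Ω T : Type*} [MeasurableSpace Ω] (P : Measure Ω)
    (k : T → T → ℝ) (X : T → Ω → ℝ) : Prop where
  isGaussianProcess : IsGaussianProcess X P
  measurable : ∀ t, Measurable (X t)
  mean_eq_zero : ∀ t, ∫ ω, X t ω ∂P = 0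
  covariance_eq : ∀ s t, cov[X s, X t; P] = k s t

/-- The layers of a 2-layer zero-mean deep Gaussian process of width `H` on `ℝ^D`, with layer
covariances `k₁` and `k₂`: the coordinates `f₁ 0, …, f₁ (H - 1)` of the first layer are i.i.d.
`GP(0, k₁)`, the second layer `f₂` is a `GP(0, k₂)` on `ℝ^H`, and the second layer is independent
of the first one.

Evaluating `f₂` at the random point `f₁ x` involves uncountably many of the variables `f₂ z` at
once. Independence of the layers is therefore expressed by a σ-algebra `m₂`, independent of the
first layer, for which `f₂` is jointly measurable in its argument and in `ω`. In particular this
holds if the layers live on the two factors of a product probability space and `f₂` is jointly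
measurable. -/
structure IsTwoLayerDeepGP {Ω : Type*} [mΩ : MeasurableSpace Ω] (P : Measure Ω) {D H : ℕ}
    (k₁ : EuclideanSpace ℝ (Fin D) → EuclideanSpace ℝ (Fin D) → ℝ)
    (k₂ : EuclideanSpace ℝ (Fin H) → EuclideanSpace ℝ (Fin H) → ℝ)
    (f₁ : Fin H → EuclideanSpace ℝ (Fin D) → Ω → ℝ)
    (f₂ : EuclideanSpace ℝ (Fin H) → Ω → ℝ) : Prop where
  isProbabilityMeasure : IsProbabilityMeasure P
  first_layer : ∀ j, IsZeroMeanGP P k₁ (f₁ j)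
  first_layer_indep : iIndepFun (fun j ω x => f₁ j x ω) P
  second_layer : IsZeroMeanGP P k₂ f₂
  layers_indep : ∃ m₂ : MeasurableSpace Ω, m₂ ≤ mΩ ∧
    Measurable[MeasurableSpace.prod inferInstance m₂]
      (fun p : EuclideanSpace ℝ (Fin H) × Ω => f₂ p.1 p.2) ∧
    Indep (⨆ (j : Fin H) (x : EuclideanSpace ℝ (Fin D)),
      MeasurableSpace.comap (f₁ j x) inferInstance) m₂ P

/-- The composition `x ↦ f₂ (f₁ x)` of two random layers. -/
def composeLayers {Ω : Type*} {D H : ℕ}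
    (f₁ : Fin H → EuclideanSpace ℝ (Fin D) → Ω → ℝ)
    (f₂ : EuclideanSpace ℝ (Fin H) → Ω → ℝ) (x : EuclideanSpace ℝ (Fin D)) (ω : Ω) : ℝ :=
  f₂ (WithLp.toLp 2 fun j => f₁ j x ω) ω

/-! The statement combines Schoenberg's theorem on kernels that are isotropic in every dimension
with a two-layer construction realising the resulting mixture of Gaussian kernels.

Points √rᵢ on distinct coordinate axes have squared distances rᵢ + rⱼ, so validity in all dimensions
makes φ positive definite on the semigroup [0, ∞) (`isBoundedPosDef_of_isotropicKernel`). For a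
bounded function of this kind all iterated differences have the sign required by Hausdorff's moment
condition. Bernstein weights then give discrete measures on [0, 1] with approximately the right
moments, and compactness gives a measure whose moment of each dyadic order r is φ(r)/φ(0).
Continuity at 0 excludes an atom at x = 0, and β = -2 log x turns moments into a Laplace transform
(`IsBoundedPosDef.exists_laplace`).

For the process, k₂ is an inner product of features in L²(μ). Expanding these in a Hilbert basis and
attaching independent normal coefficients gives a jointly measurable `GP(0, k₂)`
(`exists_isZeroMeanGP_additiveSpectralKernel`). The first layer is x ↦ ⟨x, Wⱼ⟩ with standard
Gaussian Wⱼ. Given W, the covariance is k₂ at the two images; averaging cos(√β⟨x - x', Wⱼ⟩) over Wⱼ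
gives exp(-β‖x - x'‖²/2), whose μ-integral is φ(‖x - x'‖²)
(`integral_additiveSpectralKernel_linearLayer`). -/

/-- A bounded positive definite function on the additive semigroup `[0, ∞)`. -/
structure IsBoundedPosDef (ψ : ℝ → ℝ) : Prop where
  bounded : ∃ C, ∀ t, 0 ≤ t → |ψ t| ≤ C
  posDef : ∀ (n : ℕ) (c r : Fin n → ℝ), (∀ i, 0 ≤ r i) →
    0 ≤ ∑ i, ∑ j, c i * c j * ψ (r i + r j)

/-! ### Positive definite functions on the semigroup [0, ∞) -/

namespace IsBoundedPosDef

variable {ψ : ℝ → ℝ}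

lemma posDef_fintype (hψ : IsBoundedPosDef ψ) {ι : Type*} [Fintype ι] (c r : ι → ℝ)
    (hr : ∀ i, 0 ≤ r i) : 0 ≤ ∑ i, ∑ j, c i * c j * ψ (r i + r j) := by
  have e := Fintype.equivFin ι
  have := hψ.posDef _ (c ∘ e.symm) (r ∘ e.symm) fun i => hr _
  rw [← e.symm.sum_comp]
  refine this.trans_eq (Finset.sum_congr rfl fun i _ => ?_)
  rw [← e.symm.sum_comp]
  rfl

lemma nonneg (hψ : IsBoundedPosDef ψ) {t : ℝ} (ht : 0 ≤ t) : 0 ≤ ψ t := by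
  have := hψ.posDef 1 (fun _ => 1) (fun _ => t / 2) (fun _ => by positivity)
  simpa using this

/-- Cauchy–Schwarz for the quadratic form on the two points 0 and t. -/
lemma sq_le (hψ : IsBoundedPosDef ψ) {t : ℝ} (ht : 0 ≤ t) : ψ t ^ 2 ≤ ψ 0 * ψ (2 * t) := by
  have h (a b : ℝ) : 0 ≤ a * a * ψ 0 + a * b * ψ t + (b * a * ψ t + b * b * ψ (t + t)) := by
    have := hψ.posDef 2 ![a, b] ![0, t] (fun i => by fin_cases i <;> simp [ht])
    simpa [Fin.sum_univ_two] using this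
  rw [two_mul]
  have h0 := hψ.nonneg le_rfl
  rcases h0.eq_or_lt with h0 | h0
  · by_contra! hlt
    have hne : ψ t ≠ 0 := by rintro h'; simp [h', ← h0] at hlt
    -- With ψ 0 = 0 the form is affine in its first weight; this choice gives it the value -1.
    have := h (-(ψ (t + t) + 1) / (2 * ψ t)) 1
    have h2 : -(ψ (t + t) + 1) / (2 * ψ t) * ψ t = -(ψ (t + t) + 1) / 2 := by field_simp
    rw [← h0, mul_one, one_mul, h2] at this
    linarith
  · have := h (-ψ t) (ψ 0)
    nlinarith

/-- Iterating `sq_le` along t, 2t, 4t, … makes a ratio q = ψ t / ψ 0 > 1 grow like q ^ 2 ^ k,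
against boundedness. -/
lemma le_zero (hψ : IsBoundedPosDef ψ) {t : ℝ} (ht : 0 ≤ t) : ψ t ≤ ψ 0 := by
  obtain ⟨C, hC⟩ := hψ.bounded
  have h0 := hψ.nonneg le_rfl
  by_contra! hlt
  have ht0 : 0 < ψ t := h0.trans_lt hlt
  have hpos : 0 < ψ 0 := by
    rcases h0.eq_or_lt with h | h
    · have := hψ.sq_le ht
      rw [← h] at this
      nlinarith
    · exact h
  set q := ψ t / ψ 0 with hq
  have hq1 : 1 < q := by rwa [hq, one_lt_div hpos]
  have key (k : ℕ) : ψ 0 * q ^ (2 ^ k) ≤ ψ (2 ^ k * t) := by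
    induction k with
    | zero => simp [hq]; field_simp; rfl
    | succ k ih =>
      have h1 := hψ.sq_le (t := 2 ^ k * t) (by positivity)
      have h2 : (ψ 0 * q ^ (2 ^ k)) ^ 2 ≤ ψ (2 ^ k * t) ^ 2 :=
        pow_le_pow_left₀ (by positivity) ih 2
      have h3 : ψ 0 * (ψ 0 * q ^ 2 ^ (k + 1)) ≤ ψ 0 * ψ (2 ^ (k + 1) * t) := by
        calc _ = (ψ 0 * q ^ (2 ^ k)) ^ 2 := by rw [pow_succ 2 k, pow_mul]; ring
          _ ≤ _ := h2.trans h1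
          _ = _ := by rw [pow_succ']; ring_nf
      exact le_of_mul_le_mul_left h3 hpos
  have htop : Tendsto (fun k : ℕ => ψ 0 * q ^ (2 ^ k)) atTop atTop :=
    ((tendsto_pow_atTop_atTop_of_one_lt hq1).comp
      (tendsto_pow_atTop_atTop_of_one_lt one_lt_two)).const_mul_atTop hpos
  obtain ⟨k, hk⟩ := (htop.eventually_gt_atTop C).exists
  exact absurd ((le_abs_self _).trans (hC (2 ^ k * t) (by positivity))) (by linarith [key k])

lemma shift (hψ : IsBoundedPosDef ψ) {h : ℝ} (hh : 0 ≤ h) :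
    IsBoundedPosDef fun t => ψ (t + h) where
  bounded := by
    obtain ⟨C, hC⟩ := hψ.bounded
    exact ⟨C, fun t ht => hC _ (by positivity)⟩
  posDef n c r hr := by
    have := hψ.posDef n c (fun i => r i + h / 2) fun i => by have := hr i; positivity
    simp only [show ∀ i j, r i + h / 2 + (r j + h / 2) = r i + r j + h by intros; ring] at this
    exact this

/-- Testing ψ with the product weights d i * c k at the points s i + r k shows positive
definiteness. This is what lets `le_zero` act on quadratic forms in `sub_shift`. -/
lemma sum_shift (hψ : IsBoundedPosDef ψ) {n : ℕ} (c r : Fin n → ℝ) (hr : ∀ i, 0 ≤ r i) :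
    IsBoundedPosDef fun t => ∑ i, ∑ j, c i * c j * ψ (r i + r j + t) where
  bounded := by
    obtain ⟨C, hC⟩ := hψ.bounded
    refine ⟨∑ i, ∑ j, |c i * c j| * C, fun t ht => ?_⟩
    refine (Finset.abs_sum_le_sum_abs _ _).trans (Finset.sum_le_sum fun i _ => ?_)
    refine (Finset.abs_sum_le_sum_abs _ _).trans (Finset.sum_le_sum fun j _ => ?_)
    rw [abs_mul]
    gcongr
    exact hC _ (by have := hr i; have := hr j; positivity)
  posDef m d s hs := by
    have := hψ.posDef_fintype (ι := Fin m × Fin n) (fun p => d p.1 * c p.2)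
      (fun p => s p.1 + r p.2) fun p => add_nonneg (hs _) (hr _)
    simp only [Fintype.sum_prod_type] at this
    refine this.trans_eq (Finset.sum_congr rfl fun i _ => ?_)
    rw [Finset.sum_comm]
    refine Finset.sum_congr rfl fun j _ => ?_
    simp only [Finset.mul_sum]
    refine Finset.sum_congr rfl fun k _ => Finset.sum_congr rfl fun l _ => ?_
    rw [show s i + r k + (s j + r l) = r k + r l + (s i + s j) by ring]
    ring

/-- The quadratic form of this difference is the drop from 0 to h of the function in `sum_shift`,
which `le_zero` makes nonnegative. Closure under differences is the source of complete monotonicity.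
-/
lemma sub_shift (hψ : IsBoundedPosDef ψ) {h : ℝ} (hh : 0 ≤ h) :
    IsBoundedPosDef fun t => ψ t - ψ (t + h) where
  bounded := by
    obtain ⟨C, hC⟩ := hψ.bounded
    exact ⟨C + C, fun t ht => (abs_sub _ _).trans (add_le_add (hC _ ht) (hC _ (by positivity)))⟩
  posDef n c r hr := by
    have := (hψ.sum_shift c r hr).le_zero hh
    simp only [mul_sub, Finset.sum_sub_distrib]
    simpa using this

lemma antitoneOn (hψ : IsBoundedPosDef ψ) : AntitoneOn ψ (Set.Ici 0) := by
  intro s hs t ht hst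
  have := (hψ.sub_shift (sub_nonneg.2 hst)).nonneg hs
  simpa using this

end IsBoundedPosDef

/-! ### Hausdorff's moment problem through Bernstein polynomials -/

/-- The linear functional on polynomials that sends `X ^ k` to `ψ (k * h)`. -/
noncomputable def sampleFunctional (ψ : ℝ → ℝ) (h : ℝ) : Polynomial ℝ →ₗ[ℝ] ℝ :=
  Polynomial.lsum fun k => ψ (k * h) • LinearMap.id

@[simp]
lemma sampleFunctional_X_pow (ψ : ℝ → ℝ) (h : ℝ) (k : ℕ) :
    sampleFunctional ψ h (Polynomial.X ^ k) = ψ (k * h) := by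
  simp [sampleFunctional, Polynomial.lsum_apply, ← Polynomial.monomial_one_right_eq_X_pow,
    Polynomial.sum_monomial_index]

lemma sampleFunctional_X_mul (ψ : ℝ → ℝ) (h : ℝ) (p : Polynomial ℝ) :
    sampleFunctional ψ h (Polynomial.X * p) = sampleFunctional (fun t => ψ (t + h)) h p := by
  induction p using Polynomial.induction_on' with
  | add p q hp hq => rw [mul_add, map_add, map_add, hp, hq]
  | monomial n a =>
    rw [← Polynomial.C_mul_X_pow_eq_monomial, ← Polynomial.smul_eq_C_mul, mul_smul_comm, map_smul,
      map_smul, ← pow_succ', sampleFunctional_X_pow, sampleFunctional_X_pow]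
    push_cast
    rw [add_one_mul]

lemma sampleFunctional_sub (ψ χ : ℝ → ℝ) (h : ℝ) (p : Polynomial ℝ) :
    sampleFunctional (fun t => ψ t - χ t) h p =
      sampleFunctional ψ h p - sampleFunctional χ h p := by
  induction p using Polynomial.induction_on' with
  | add p q hp hq => rw [map_add, map_add, map_add, hp, hq]; ring
  | monomial n a =>
    rw [← Polynomial.C_mul_X_pow_eq_monomial, ← Polynomial.smul_eq_C_mul, map_smul,
      map_smul, map_smul, sampleFunctional_X_pow, sampleFunctional_X_pow, sampleFunctional_X_pow]
    simp [mul_sub]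

/-- A factor X shifts ψ by h and a factor 1 - X takes the difference ψ - ψ(· + h); both operations
preserve the class, so induction reduces to ψ 0 ≥ 0. -/
lemma IsBoundedPosDef.sampleFunctional_nonneg {ψ : ℝ → ℝ} (hψ : IsBoundedPosDef ψ) {h : ℝ}
    (hh : 0 ≤ h) (k m : ℕ) :
    0 ≤ sampleFunctional ψ h (Polynomial.X ^ k * (1 - Polynomial.X) ^ m) := by
  induction k generalizing ψ with
  | zero =>
    induction m generalizing ψ with
    | zero => simpa using sampleFunctional_X_pow ψ h 0 ▸ hψ.nonneg (by simp)
    | succ m ih =>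
      have := ih (hψ.sub_shift hh)
      rw [sampleFunctional_sub, ← sampleFunctional_X_mul, ← map_sub] at this
      convert this using 2
      ring
  | succ k ih =>
    have := ih (hψ.shift hh)
    rw [← sampleFunctional_X_mul] at this
    convert this using 2
    ring

/-- The factorial moments of the binomial distribution: absorbing the falling factorial into the
binomial coefficient leaves the Bernstein partition of unity of degree n - m. -/
lemma sum_descFactorial_mul_bernsteinPolynomial (n m : ℕ) :
    ∑ k ∈ Finset.range (n + 1), (k.descFactorial m : ℝ) • bernsteinPolynomial ℝ n k =
      (n.descFactorial m : ℝ) • Polynomial.X ^ m := by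
  rcases lt_or_ge n m with h | h
  · rw [Nat.descFactorial_of_lt h]
    simp only [Nat.cast_zero, zero_smul]
    refine Finset.sum_eq_zero fun k hk => ?_
    rw [Nat.descFactorial_of_lt (by grind)]
    simp
  · obtain ⟨l, rfl⟩ := Nat.exists_eq_add_of_le h
    have h1 : ∑ k ∈ Finset.range m, (k.descFactorial m : ℝ) • bernsteinPolynomial ℝ (m + l) k = 0 :=
      Finset.sum_eq_zero fun k hk => by
        rw [Nat.descFactorial_of_lt (by grind)]
        simp
    rw [add_assoc, Finset.sum_range_add, h1, zero_add,
      ← mul_one (Polynomial.X ^ m), ← bernsteinPolynomial.sum ℝ l, Finset.mul_sum,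
      Finset.smul_sum]
    refine Finset.sum_congr rfl fun i hi => ?_
    have h2 := Nat.choose_mul (n := m + l) (k := m + i) (s := m) (by grind)
    have h3 : (m + i).descFactorial m * (m + l).choose (m + i) =
        (m + l).descFactorial m * l.choose i := by
      rw [Nat.descFactorial_eq_factorial_mul_choose, Nat.descFactorial_eq_factorial_mul_choose,
        mul_assoc, mul_assoc, mul_comm ((m + i).choose m), h2]
      simp
    simp only [bernsteinPolynomial, Polynomial.smul_eq_C_mul, Polynomial.C_eq_natCast]
    rw [show m + l - (m + i) = l - i by omega, pow_add]
    have h4 : (((m + i).descFactorial m : ℕ) : Polynomial ℝ) * ((m + l).choose (m + i) : ℕ) =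
        ((m + l).descFactorial m : ℕ) * (l.choose i : ℕ) := by exact_mod_cast h3
    linear_combination
      (Polynomial.X ^ m * Polynomial.X ^ i * (1 - Polynomial.X) ^ (l - i) : Polynomial ℝ) * h4

lemma descFactorial_approx (n k m : ℕ) (hk : k ≤ n) :
    0 ≤ (k : ℝ) ^ m - k.descFactorial m ∧
      n * ((k : ℝ) ^ m - k.descFactorial m) ≤ m ^ 2 * n ^ m := by
  induction m with
  | zero => simp
  | succ m ih =>
    have hk' : (k : ℝ) ≤ n := by exact_mod_cast hk
    have hd : ((k.descFactorial (m + 1) : ℕ) : ℝ) = (k - m) * k.descFactorial m := by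
      rw [Nat.descFactorial_succ, Nat.cast_mul]
      rcases le_or_gt m k with h | h
      · rw [Nat.cast_sub h]
      · simp [Nat.descFactorial_of_lt h]
    obtain ⟨h1, h2⟩ := ih
    set d : ℝ := (k.descFactorial m : ℝ)
    have hd0 : 0 ≤ d := Nat.cast_nonneg _
    have hdn : d ≤ n ^ m := (sub_nonneg.1 h1).trans (pow_le_pow_left₀ (by positivity) hk' m)
    rw [hd, pow_succ]
    have h3 : (k : ℝ) ^ m * k - (k - m) * d = k * (k ^ m - d) + m * d := by ring
    rw [h3]
    refine ⟨by positivity, ?_⟩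
    have h4 : k * (n * ((k : ℝ) ^ m - d)) ≤ n * (m ^ 2 * n ^ m) := by gcongr
    have h5 : n * (m * d) ≤ n * (m * (n : ℝ) ^ m) := by gcongr
    push_cast
    have h6 : 0 ≤ (m + 1) * ((n : ℝ) * n ^ m) := by positivity
    have h7 : ((m : ℝ) + 1) ^ 2 * n ^ (m + 1) =
      n * (m ^ 2 * n ^ m) + n * (m * n ^ m) + (m + 1) * (n * n ^ m) := by ring
    rw [h7]
    linarith

namespace IsBoundedPosDef

variable {ψ : ℝ → ℝ}

lemma sampleFunctional_bernsteinPolynomial_nonneg (hψ : IsBoundedPosDef ψ) {h : ℝ} (hh : 0 ≤ h)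
    (n k : ℕ) : 0 ≤ sampleFunctional ψ h (bernsteinPolynomial ℝ n k) := by
  rw [bernsteinPolynomial, mul_assoc, ← nsmul_eq_mul, map_nsmul]
  exact nsmul_nonneg (hψ.sampleFunctional_nonneg hh _ _) _

lemma sum_sampleFunctional_bernsteinPolynomial (ψ : ℝ → ℝ) (h : ℝ) (n : ℕ) :
    ∑ k ∈ Finset.range (n + 1), sampleFunctional ψ h (bernsteinPolynomial ℝ n k) = ψ 0 := by
  rw [← map_sum, bernsteinPolynomial.sum, ← pow_zero Polynomial.X, sampleFunctional_X_pow]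
  simp

/-- Falling-factorial moments of the Bernstein weights are exact. Replacing falling factorials by
powers costs at most ψ 0 * m ^ 2 / n twice: once in the sum, once in the normalisation of ψ (m * h).
-/
lemma abs_sum_sampleFunctional_sub_le (hψ : IsBoundedPosDef ψ) {h : ℝ} (hh : 0 ≤ h)
    {n : ℕ} (hn : 0 < n) (m : ℕ) :
    |∑ k ∈ Finset.range (n + 1),
      sampleFunctional ψ h (bernsteinPolynomial ℝ n k) * ((k : ℝ) / n) ^ m - ψ (m * h)| ≤
      2 * ψ 0 * m ^ 2 / n := by
  have hn' : (0 : ℝ) < n := by exact_mod_cast hn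
  set w := fun k => sampleFunctional ψ h (bernsteinPolynomial ℝ n k) with hw
  have hw0 : ∀ k, 0 ≤ w k := hψ.sampleFunctional_bernsteinPolynomial_nonneg hh n
  have hsum : ∑ k ∈ Finset.range (n + 1), w k * k.descFactorial m =
      n.descFactorial m * ψ (m * h) := by
    have := congrArg (sampleFunctional ψ h) (sum_descFactorial_mul_bernsteinPolynomial n m)
    rw [map_sum, map_smul, sampleFunctional_X_pow, smul_eq_mul] at this
    rw [← this]
    exact Finset.sum_congr rfl fun k _ => by rw [map_smul, smul_eq_mul, mul_comm]
  have happ : ∀ k ∈ Finset.range (n + 1), 0 ≤ ((k : ℝ) / n) ^ m - k.descFactorial m / n ^ m ∧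
      ((k : ℝ) / n) ^ m - k.descFactorial m / n ^ m ≤ m ^ 2 / n := by
    intro k hk
    obtain ⟨h1, h2⟩ := descFactorial_approx n k m (by grind)
    rw [div_pow, ← sub_div]
    refine ⟨by positivity, ?_⟩
    rw [div_le_div_iff₀ (by positivity) hn']
    linarith
  have hψm0 := hψ.nonneg (show 0 ≤ m * h by positivity)
  have hψm := hψ.le_zero (show 0 ≤ m * h by positivity)
  have hA : ∑ k ∈ Finset.range (n + 1), w k * ((k : ℝ) / n) ^ m - ψ (m * h) =
      ∑ k ∈ Finset.range (n + 1), w k * (((k : ℝ) / n) ^ m - k.descFactorial m / n ^ m) -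
        (((n : ℝ) / n) ^ m - n.descFactorial m / n ^ m) * ψ (m * h) := by
    simp only [mul_sub, Finset.sum_sub_distrib, ← mul_div_assoc, ← Finset.sum_div]
    rw [hsum, div_self hn'.ne', one_pow]
    ring
  have h1 : 0 ≤ ∑ k ∈ Finset.range (n + 1),
      w k * (((k : ℝ) / n) ^ m - k.descFactorial m / n ^ m) :=
    Finset.sum_nonneg fun k hk => mul_nonneg (hw0 k) (happ k hk).1
  have h2 : ∑ k ∈ Finset.range (n + 1),
      w k * (((k : ℝ) / n) ^ m - k.descFactorial m / n ^ m) ≤ ψ 0 * (m ^ 2 / n) := by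
    rw [← sum_sampleFunctional_bernsteinPolynomial ψ h n, Finset.sum_mul]
    exact Finset.sum_le_sum fun k hk => mul_le_mul_of_nonneg_left (happ k hk).2 (hw0 k)
  obtain ⟨h3, h4⟩ := happ n (by simp)
  have h5 : (((n : ℝ) / n) ^ m - n.descFactorial m / n ^ m) * ψ (m * h) ≤ m ^ 2 / n * ψ 0 :=
    mul_le_mul h4 hψm hψm0 (by positivity)
  have h6 := mul_nonneg h3 hψm0
  have h7 : 2 * ψ 0 * m ^ 2 / n = ψ 0 * (m ^ 2 / n) + m ^ 2 / n * ψ 0 := by ring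
  rw [hA, h7, abs_le]
  have h8 := hψ.nonneg le_rfl
  have h9 : 0 ≤ ψ 0 * ((m : ℝ) ^ 2 / n) := by positivity
  constructor <;> linarith

lemma exists_probabilityMeasure_approx (hψ : IsBoundedPosDef ψ) (h0 : 0 < ψ 0) (N : ℕ) :
    ∃ p : ProbabilityMeasure unitInterval, ∀ (r : ℝ) (m : ℕ), (m : ℝ) = r * 2 ^ N →
      |∫ x : unitInterval, (x : ℝ) ^ r ∂(p : Measure unitInterval) - ψ r / ψ 0| ≤
        2 * r ^ 2 * (1 / 2) ^ N := by
  -- The degree must beat m ^ 2 = r ^ 2 * 4 ^ N; the choice 8 ^ N leaves the error 2 * r ^ 2 / 2 ^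
  -- N.
  set n := 8 ^ N with hn
  have hn0 : 0 < n := by positivity
  have hn' : (0 : ℝ) < n := by exact_mod_cast hn0
  set h : ℝ := (2 ^ N)⁻¹ with hh
  have hh0 : 0 ≤ h := by positivity
  set w := fun k => sampleFunctional ψ h (bernsteinPolynomial ℝ n k) with hw
  have hw0 : ∀ k, 0 ≤ w k := hψ.sampleFunctional_bernsteinPolynomial_nonneg hh0 n
  -- Raising the nodes to the power 2 ^ N = 1 / h makes the r-th power of a node equal to (k / n) ^
  -- m, so one measure serves all r on the grid.
  let y : ℕ → unitInterval := fun k => Set.projIcc 0 1 zero_le_one (((k : ℝ) / n) ^ (2 ^ N))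
  let ρ : Measure unitInterval :=
    ∑ k ∈ Finset.range (n + 1), ENNReal.ofReal (w k / ψ 0) • Measure.dirac (y k)
  have hρ : IsProbabilityMeasure ρ := by
    constructor
    simp only [ρ, Measure.coe_finsetSum, Finset.sum_apply, Measure.smul_apply, measure_univ,
      smul_eq_mul, mul_one]
    rw [← ENNReal.ofReal_sum_of_nonneg fun k _ => div_nonneg (hw0 k) h0.le, ← Finset.sum_div,
      sum_sampleFunctional_bernsteinPolynomial, div_self h0.ne', ENNReal.ofReal_one]
  refine ⟨⟨ρ, hρ⟩, fun r m hm => ?_⟩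
  have hr : 0 ≤ r := by
    by_contra! hr
    have : r * 2 ^ N < 0 := mul_neg_of_neg_of_pos hr (by positivity)
    exact absurd (Nat.cast_nonneg (α := ℝ) m) (by linarith)
  have hy : ∀ k ∈ Finset.range (n + 1), ((y k : ℝ)) ^ r = ((k : ℝ) / n) ^ m := by
    intro k hk
    have hk' : (k : ℝ) ≤ n := by exact_mod_cast (by grind : k ≤ n)
    have hk1 : (k : ℝ) / n ≤ 1 := (div_le_one hn').2 hk'
    have hk0 : 0 ≤ (k : ℝ) / n := by positivity
    simp only [y]
    rw [Set.projIcc_of_mem zero_le_one ⟨by positivity, pow_le_one₀ hk0 hk1⟩]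
    simp only
    rw [← Real.rpow_natCast, ← Real.rpow_mul hk0, ← Real.rpow_natCast, hm]
    push_cast
    rw [mul_comm]
  have hint : ∫ x : unitInterval, (x : ℝ) ^ r ∂ρ =
      (∑ k ∈ Finset.range (n + 1), w k * ((k : ℝ) / n) ^ m) / ψ 0 := by
    simp only [ρ]
    rw [integral_finsetSum_measure, Finset.sum_div]
    · refine Finset.sum_congr rfl fun k hk => ?_
      rw [integral_smul_measure, integral_dirac, hy k hk,
        ENNReal.toReal_ofReal (div_nonneg (hw0 k) h0.le), smul_eq_mul]
      ring
    · intro k hk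
      refine Integrable.smul_measure ?_ ENNReal.ofReal_ne_top
      exact integrable_dirac (by simp)
  have key := hψ.abs_sum_sampleFunctional_sub_le hh0 hn0 m
  have hmh : m * h = r := by rw [hm, hh]; field_simp
  rw [hmh] at key
  change |∫ x : unitInterval, (x : ℝ) ^ r ∂ρ - ψ r / ψ 0| ≤ _
  rw [hint, ← sub_div, abs_div, abs_of_pos h0, div_le_iff₀ h0]
  refine key.trans_eq ?_
  rw [hm, hn]
  push_cast
  have h8 : (8 : ℝ) ^ N = 2 ^ N * 2 ^ N * 2 ^ N := by rw [← mul_pow, ← mul_pow]; norm_num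
  rw [h8, div_pow, one_pow]
  field_simp

lemma exists_probabilityMeasure (hψ : IsBoundedPosDef ψ) (h0 : 0 < ψ 0) :
    ∃ p : ProbabilityMeasure unitInterval, ∀ a j : ℕ,
      ∫ x : unitInterval, (x : ℝ) ^ ((a : ℝ) / 2 ^ j) ∂(p : Measure unitInterval) =
        ψ ((a : ℝ) / 2 ^ j) / ψ 0 := by
  choose u hu using hψ.exists_probabilityMeasure_approx h0
  -- Probability measures on [0, 1] form a compact space, so the approximations converge along an
  -- ultrafilter.
  let F : Ultrafilter (ProbabilityMeasure unitInterval) := (hyperfilter ℕ).map u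
  have hF : Tendsto u (hyperfilter ℕ) (𝓝 F.lim) := F.le_nhds_lim
  refine ⟨F.lim, fun a j => ?_⟩
  set r : ℝ := (a : ℝ) / 2 ^ j with hr
  have hr0 : 0 ≤ r := by positivity
  let f : BoundedContinuousFunction unitInterval ℝ := BoundedContinuousFunction.mkOfCompact
    ⟨fun x => (x : ℝ) ^ r, continuous_subtype_val.rpow_const fun _ => Or.inr hr0⟩
  have h1 := (ProbabilityMeasure.tendsto_iff_forall_integral_tendsto.1 hF) f
  refine tendsto_nhds_unique h1 ?_
  have h2 : Tendsto (fun N : ℕ => ∫ x, f x ∂(u N : Measure unitInterval)) atTop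
      (𝓝 (ψ r / ψ 0)) := by
    have h3 : Tendsto (fun N : ℕ => 2 * r ^ 2 * (1 / 2 : ℝ) ^ N) atTop (𝓝 0) := by
      simpa using (tendsto_pow_atTop_nhds_zero_of_lt_one (by norm_num : (0 : ℝ) ≤ 1 / 2)
        (by norm_num)).const_mul (2 * r ^ 2)
    rw [tendsto_iff_norm_sub_tendsto_zero]
    refine squeeze_zero' (Eventually.of_forall fun _ => norm_nonneg _) ?_ h3
    filter_upwards [eventually_ge_atTop j] with N hN
    refine hu N r (a * 2 ^ (N - j)) ?_
    obtain ⟨l, rfl⟩ := Nat.exists_eq_add_of_le hN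
    rw [hr, pow_add]
    push_cast
    simp
    field_simp
  exact h2.mono_left Nat.hyperfilter_le_atTop

/-! ### From moments to the Laplace transform -/

theorem exists_laplace (hψ : IsBoundedPosDef ψ)
    (hcont : Tendsto (fun N : ℕ => ψ (1 / 2 ^ N)) atTop (𝓝 (ψ 0))) :
    ∃ μ : Measure ℝ≥0, IsFiniteMeasure μ ∧
      ∀ r : ℝ, 0 ≤ r → ψ r = ∫ β : ℝ≥0, Real.exp (-(1 / 2) * r * (β : ℝ)) ∂μ := by
  rcases (hψ.nonneg le_rfl).eq_or_lt with h0 | h0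
  · refine ⟨0, inferInstance, fun r hr => ?_⟩
    simpa using le_antisymm (h0 ▸ hψ.le_zero hr) (hψ.nonneg hr)
  obtain ⟨⟨q, hq⟩, hp⟩ := hψ.exists_probabilityMeasure h0
  simp only [ProbabilityMeasure.coe_mk] at hp
  -- As N grows, x ^ (1 / 2 ^ N) tends to the indicator of x ≠ 0, while its integral tends to 1 by
  -- continuity of ψ at 0.
  have hae : ∀ᵐ x : unitInterval ∂q, (x : ℝ) ≠ 0 := by
    have h1 : Tendsto (fun N : ℕ => ∫ x : unitInterval, (x : ℝ) ^ ((1 : ℝ) / 2 ^ N) ∂q) atTop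
        (𝓝 (∫ x : unitInterval, Set.indicator {x : unitInterval | (x : ℝ) ≠ 0} 1 x ∂q)) := by
      refine tendsto_integral_of_dominated_convergence (fun _ => 1) (fun N => ?_) (by simp)
        (fun N => ae_of_all _ fun x => ?_) (ae_of_all _ fun x => ?_)
      · exact (continuous_subtype_val.rpow_const
          fun _ => Or.inr (by positivity)).aestronglyMeasurable
      · rw [Real.norm_eq_abs, abs_of_nonneg (Real.rpow_nonneg x.2.1 _)]
        exact Real.rpow_le_one x.2.1 x.2.2 (by positivity)
      · rcases eq_or_ne (x : ℝ) 0 with hx | hx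
        · have hx' : x ∉ {x : unitInterval | (x : ℝ) ≠ 0} := fun h => h hx
          rw [Set.indicator_of_notMem hx', hx]
          refine tendsto_const_nhds.congr fun N => (Real.zero_rpow ?_).symm
          positivity
        · have : Tendsto (fun N : ℕ => (1 : ℝ) / 2 ^ N) atTop (𝓝 0) := by
            simpa using tendsto_pow_atTop_nhds_zero_of_lt_one (by norm_num : (0 : ℝ) ≤ 2⁻¹)
              (by norm_num)
          have hx' : x ∈ {x : unitInterval | (x : ℝ) ≠ 0} := hx
          have h6 := (Real.continuousAt_const_rpow hx).tendsto.comp this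
          rw [Real.rpow_zero] at h6
          rwa [Set.indicator_of_mem hx', Pi.one_apply]
    have h2 : Tendsto (fun N : ℕ => ∫ x : unitInterval, (x : ℝ) ^ ((1 : ℝ) / 2 ^ N) ∂q) atTop
        (𝓝 1) := by
      have := hcont.div_const (ψ 0)
      rw [div_self h0.ne'] at this
      refine this.congr fun N => ?_
      simpa using (hp 1 N).symm
    have hms : MeasurableSet {x : unitInterval | (x : ℝ) ≠ 0} :=
      (measurableSet_singleton (0 : ℝ)).compl.preimage measurable_subtype_coe
    have h3 := tendsto_nhds_unique h1 h2
    rw [integral_indicator_one hms] at h3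
    have h4 : q {x : unitInterval | (x : ℝ) ≠ 0} = 1 := by
      rw [← ENNReal.toReal_eq_one_iff]; exact h3
    exact (prob_compl_eq_zero_iff hms).2 h4
  have hmeas : Measurable fun x : unitInterval => Real.toNNReal (-2 * Real.log x) := by fun_prop
  set ν : Measure ℝ≥0 := q.map fun x : unitInterval => Real.toNNReal (-2 * Real.log x) with hν
  have hνp : IsProbabilityMeasure ν := Measure.isProbabilityMeasure_map hmeas.aemeasurable
  let G : ℝ → ℝ := fun r => ψ 0 * ∫ β : ℝ≥0, Real.exp (-(1 / 2) * r * (β : ℝ)) ∂ν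
  have hG : ∀ a j : ℕ, G (a / 2 ^ j) = ψ (a / 2 ^ j) := by
    intro a j
    simp only [G]
    rw [hν, integral_map hmeas.aemeasurable (by fun_prop)]
    have := hp a j
    rw [eq_div_iff h0.ne', mul_comm] at this
    rw [← this]
    congr 1
    refine integral_congr_ae ?_
    filter_upwards [hae] with x hx
    have hx0 : 0 < (x : ℝ) := lt_of_le_of_ne x.2.1 (Ne.symm hx)
    rw [Real.rpow_def_of_pos hx0, Real.coe_toNNReal]
    · congr 1; ring
    · have := Real.log_nonpos x.2.1 x.2.2
      linarith
  have hGcont : ∀ {r : ℝ} {s : ℕ → ℝ}, (∀ N, 0 ≤ s N) → Tendsto s atTop (𝓝 r) →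
      Tendsto (fun N => G (s N)) atTop (𝓝 (G r)) := by
    intro r s hs0 hs
    refine Tendsto.const_mul _ ?_
    refine tendsto_integral_of_dominated_convergence (fun _ => 1) (fun N => by fun_prop) (by simp)
        (fun N => ae_of_all _ fun β => ?_) (ae_of_all _ fun β => ?_)
    · rw [Real.norm_eq_abs, Real.abs_exp, Real.exp_le_one_iff]
      have := mul_nonneg (hs0 N) β.2
      have h' : -(1 / 2) * s N * (β : ℝ) = -(s N * (β : ℝ)) / 2 := by ring
      rw [h']
      have : 0 ≤ s N * (β : ℝ) := this
      linarith
    · exact (Real.continuous_exp.tendsto _).comp ((hs.const_mul _).mul_const _)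
  refine ⟨ENNReal.ofReal (ψ 0) • ν, Measure.smul_finite _ ENNReal.ofReal_ne_top, fun r hr => ?_⟩
  rw [integral_smul_measure, ENNReal.toReal_ofReal h0.le, smul_eq_mul]
  change ψ r = G r
  -- Monotonicity of ψ squeezes ψ r between its dyadic values on either side of r, where it agrees
  -- with the continuous function G.
  have hpow : Tendsto (fun N : ℕ => (2 : ℝ) ^ N) atTop atTop :=
    tendsto_pow_atTop_atTop_of_one_lt one_lt_two
  have hdown := (tendsto_nat_floor_mul_div_atTop hr).comp hpow
  have hup := (tendsto_nat_ceil_mul_div_atTop hr).comp hpow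
  apply le_antisymm
  · refine ge_of_tendsto (hGcont (fun N => by simp only [Function.comp]; positivity) hdown)
      (Eventually.of_forall fun N => ?_)
    simp only [Function.comp]
    rw [hG]
    refine hψ.antitoneOn (Set.mem_Ici.2 (by positivity)) hr ?_
    rw [div_le_iff₀ (by positivity)]
    exact Nat.floor_le (by positivity)
  · refine le_of_tendsto (hGcont (fun N => by simp only [Function.comp]; positivity) hup)
      (Eventually.of_forall fun N => ?_)
    simp only [Function.comp]
    rw [hG]
    refine hψ.antitoneOn hr (Set.mem_Ici.2 (by positivity)) ?_
    rw [le_div_iff₀ (by positivity)]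
    exact Nat.le_ceil _

end IsBoundedPosDef

/-! ### From isotropic kernels to the semigroup -/

lemma IsCovarianceFunction.sum_nonneg {T ι : Type*} [Fintype ι] {k : T → T → ℝ}
    (hk : IsCovarianceFunction k) (x : ι → T) (c : ι → ℝ) :
    0 ≤ ∑ i, ∑ j, c i * c j * k (x i) (x j) := by
  let e := Fintype.equivFin ι
  have := (hk _ (x ∘ e.symm)).dotProduct_mulVec_nonneg (c ∘ e.symm)
  rw [← e.symm.sum_comp]
  refine this.trans_eq ?_
  simp only [dotProduct, Matrix.mulVec, Matrix.of_apply, Finset.mul_sum]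
  refine Finset.sum_congr rfl fun i _ => ?_
  rw [← e.symm.sum_comp]
  refine Finset.sum_congr rfl fun j _ => ?_
  simp
  ring

lemma norm_single_sub_single_sq {ι : Type*} [Fintype ι] [DecidableEq ι] {i j : ι} (hij : i ≠ j)
    {a b : ℝ} (ha : 0 ≤ a) (hb : 0 ≤ b) :
    ‖EuclideanSpace.single i (√a) - EuclideanSpace.single j (√b)‖ ^ 2 = a + b := by
  rw [norm_sub_sq_real, EuclideanSpace.inner_single_left]
  simp [hij, Real.sq_sqrt ha, Real.sq_sqrt hb]

lemma isBoundedPosDef_of_isotropicKernel {φ : ℝ → ℝ}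
    (hcov : ∀ D : ℕ, IsCovarianceFunction (isotropicKernel φ D)) : IsBoundedPosDef φ where
  bounded := by
    refine ⟨φ 0, fun t ht => ?_⟩
    have key (a : ℝ) := (hcov 1).sum_nonneg (ι := Fin 2)
      ![0, EuclideanSpace.single 0 (√t)] ![1, a]
    have h1 := key 1
    have h2 := key (-1)
    simp [Fin.sum_univ_two, isotropicKernel, Real.sq_sqrt ht] at h1 h2
    rw [abs_le]
    constructor <;> linarith
  posDef n c r hr := by
    set S := ∑ i, ∑ j, c i * c j * φ (r i + r j) with hS
    set R := ∑ i, c i ^ 2 * (φ 0 - φ (r i + r i)) with hR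
    -- A point has distance 0 to itself, so the diagonal shows φ 0 instead of φ (r i + r i). Taking
    -- N copies of each point on separate axes makes this defect linear in N, against the quadratic
    -- main term.
    have key (N : ℕ) : 0 ≤ S * (N : ℝ) ^ 2 + R * N := by
      let e := Fintype.equivFin (Fin n × Fin N)
      have h1 := (hcov _).sum_nonneg (ι := Fin n × Fin N)
        (fun p => EuclideanSpace.single (e p) (√(r p.1))) (fun p => c p.1)
      refine h1.trans_eq ?_
      have h2 : ∀ p q : Fin n × Fin N, isotropicKernel φ _ (EuclideanSpace.single (e p) (√(r p.1)))
          (EuclideanSpace.single (e q) (√(r q.1))) =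
          φ (r p.1 + r q.1) + if p = q then φ 0 - φ (r p.1 + r p.1) else 0 := by
        intro p q
        rcases eq_or_ne p q with rfl | hpq
        · simp [isotropicKernel]
        · rw [isotropicKernel, norm_single_sub_single_sq (e.injective.ne hpq) (hr _) (hr _)]
          simp [hpq]
      simp only [h2, mul_add, Finset.sum_add_distrib, mul_ite, mul_zero, Finset.sum_ite_eq,
        Finset.mem_univ, if_true, Fintype.sum_prod_type, Finset.sum_const, Finset.card_univ,
        Fintype.card_fin, nsmul_eq_mul, hS, hR, Finset.sum_mul, Finset.mul_sum]
      congr 1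
      · exact Finset.sum_congr rfl fun i _ => Finset.sum_congr rfl fun j _ => by ring
      · exact Finset.sum_congr rfl fun i _ => by ring
    have hlim : Tendsto (fun N : ℕ => S + R * (N : ℝ)⁻¹) atTop (𝓝 (S + R * 0)) :=
      (tendsto_inv_atTop_nhds_zero_nat.const_mul R).const_add S
    rw [mul_zero, add_zero] at hlim
    refine ge_of_tendsto hlim ?_
    filter_upwards [eventually_gt_atTop 0] with N hN
    have hN' : (0 : ℝ) < N := by exact_mod_cast hN
    have h3 : S + R * (N : ℝ)⁻¹ = (S * (N : ℝ) ^ 2 + R * N) / N ^ 2 := by field_simp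
    rw [h3]
    exact div_nonneg (key N) (by positivity)

lemma tendsto_of_isMeanSquareContinuous_isotropicKernel {φ : ℝ → ℝ}
    (hcont : IsMeanSquareContinuous (isotropicKernel φ 1)) {s : ℕ → ℝ} (hs0 : ∀ n, 0 ≤ s n)
    (hs : Tendsto s atTop (𝓝 0)) : Tendsto (fun n => φ (s n)) atTop (𝓝 (φ 0)) := by
  have h1 : Tendsto (fun n => EuclideanSpace.single (0 : Fin 1) (√(s n))) atTop (𝓝 0) := by
    rw [tendsto_zero_iff_norm_tendsto_zero]
    have := (Real.continuous_sqrt.tendsto 0).comp hs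
    simpa [abs_of_nonneg (Real.sqrt_nonneg _), Function.comp_def] using this
  have h2 := (hcont 0).comp h1
  have h3 : ∀ n, φ (s n) = φ 0 - (isotropicKernel φ 1 0 0 -
      2 * isotropicKernel φ 1 0 (EuclideanSpace.single (0 : Fin 1) (√(s n))) +
      isotropicKernel φ 1 (EuclideanSpace.single (0 : Fin 1) (√(s n)))
        (EuclideanSpace.single (0 : Fin 1) (√(s n)))) / 2 := by
    intro n
    simp [isotropicKernel, Real.sq_sqrt (hs0 n)]
    ring
  simp only [h3]
  simpa using (h2.div_const 2).const_sub (φ 0)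

theorem exists_laplace_of_isotropicKernel {φ : ℝ → ℝ}
    (hcov : ∀ D : ℕ, IsCovarianceFunction (isotropicKernel φ D))
    (hcont : IsMeanSquareContinuous (isotropicKernel φ 1)) :
    ∃ μ : Measure ℝ≥0, IsFiniteMeasure μ ∧
      ∀ r : ℝ, 0 ≤ r → φ r = ∫ β : ℝ≥0, Real.exp (-(1 / 2) * r * (β : ℝ)) ∂μ := by
  refine (isBoundedPosDef_of_isotropicKernel hcov).exists_laplace
    (tendsto_of_isMeanSquareContinuous_isotropicKernel hcont (fun n => by positivity) ?_)
  simpa using tendsto_pow_atTop_nhds_zero_of_lt_one (by norm_num : (0 : ℝ) ≤ 2⁻¹) (by norm_num)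

/-! ### Gaussian series -/

/-- The law of a sequence of independent standard normal variables. -/
noncomputable def gaussianSequence : Measure (ℕ → ℝ) :=
  Measure.infinitePi fun _ => gaussianReal 0 1

namespace gaussianSequence

instance : IsProbabilityMeasure gaussianSequence :=
  inferInstanceAs (IsProbabilityMeasure (Measure.infinitePi fun _ => gaussianReal 0 1))

lemma hasLaw_eval (n : ℕ) : HasLaw (fun ω : ℕ → ℝ => ω n) (gaussianReal 0 1) gaussianSequence where
  aemeasurable := (measurable_pi_apply n).aemeasurable
  map_eq := Measure.infinitePi_map_eval _ n

lemma iIndepFun_eval : iIndepFun (fun (n : ℕ) (ω : ℕ → ℝ) => ω n) gaussianSequence :=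
  iIndepFun_infinitePi (X := fun _ x => x) fun _ => measurable_id

lemma hasGaussianLaw_eval (n : ℕ) : HasGaussianLaw (fun ω : ℕ → ℝ => ω n) gaussianSequence :=
  (hasLaw_eval n).hasGaussianLaw

lemma integral_eval (n : ℕ) : ∫ ω : ℕ → ℝ, ω n ∂gaussianSequence = 0 := by
  rw [(hasLaw_eval n).integral_eq]
  simp

lemma variance_eval (n : ℕ) : Var[fun ω : ℕ → ℝ => ω n; gaussianSequence] = 1 := by
  rw [(hasLaw_eval n).variance_eq]
  simp

variable (d : ℕ → ℝ)

lemma iIndepFun_mul : iIndepFun (fun (n : ℕ) (ω : ℕ → ℝ) => d n * ω n) gaussianSequence :=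
  iIndepFun_eval.comp (fun n x => d n * x) fun _ => by fun_prop

lemma hasGaussianLaw_mul (n : ℕ) :
    HasGaussianLaw (fun ω : ℕ → ℝ => d n * ω n) gaussianSequence :=
  (hasGaussianLaw_eval n).fun_smul (d n)

lemma integral_sum (s : Finset ℕ) : ∫ ω : ℕ → ℝ, ∑ k ∈ s, d k * ω k ∂gaussianSequence = 0 := by
  rw [integral_finsetSum _ fun k _ => (hasGaussianLaw_mul d k).integrable]
  simp [integral_const_mul, integral_eval]

lemma variance_sum (s : Finset ℕ) :
    Var[fun ω : ℕ → ℝ => ∑ k ∈ s, d k * ω k; gaussianSequence] = ∑ k ∈ s, d k ^ 2 := by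
  have h := IndepFun.variance_sum (μ := gaussianSequence) (s := s)
    (X := fun k (ω : ℕ → ℝ) => d k * ω k) (fun k _ => (hasGaussianLaw_mul d k).memLp_two)
    fun i _ j _ hij => (iIndepFun_mul d).indepFun hij
  rw [show (fun ω : ℕ → ℝ => ∑ k ∈ s, d k * ω k) = ∑ k ∈ s, fun ω => d k * ω k by ext; simp, h]
  simp [variance_const_mul, variance_eval]

lemma hasGaussianLaw_sum (n : ℕ) :
    HasGaussianLaw (fun ω : ℕ → ℝ => ∑ k ∈ Finset.range n, d k * ω k) gaussianSequence := by
  have h := iIndepFun.hasGaussianLaw_fun_sum (ι := Fin n)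
    (fun i => hasGaussianLaw_mul d i) ((iIndepFun_mul d).precomp Fin.val_injective)
  simpa only [Finset.sum_range] using h

lemma map_sum (n : ℕ) :
    gaussianSequence.map (fun ω : ℕ → ℝ => ∑ k ∈ Finset.range n, d k * ω k) =
      gaussianReal 0 (∑ k ∈ Finset.range n, d k ^ 2).toNNReal := by
  rw [(hasGaussianLaw_sum d n).map_eq_gaussianReal, integral_sum, variance_sum]

variable {d}

lemma martingale_sum (d : ℕ → ℝ) :
    Martingale (fun n (ω : ℕ → ℝ) => ∑ k ∈ Finset.range (n + 1), d k * ω k)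
      (Filtration.natural (fun (n : ℕ) (ω : ℕ → ℝ) => ω n)
        fun n => (measurable_pi_apply n).stronglyMeasurable) gaussianSequence := by
  set ℱ := Filtration.natural (fun (n : ℕ) (ω : ℕ → ℝ) => ω n)
    fun n => (measurable_pi_apply n).stronglyMeasurable with hℱ
  refine martingale_of_condExp_sub_eq_zero_nat (fun n => ?_)
    (fun n => (hasGaussianLaw_sum d (n + 1)).integrable) fun n => ?_
  · refine Finset.stronglyMeasurable_fun_sum _ fun k hk => ?_
    refine StronglyMeasurable.const_mul ?_ _
    exact (Filtration.stronglyAdapted_natural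
      fun n => (measurable_pi_apply n).stronglyMeasurable).stronglyMeasurable_le (by grind)
  · have h1 : ((fun ω : ℕ → ℝ => ∑ k ∈ Finset.range (n + 1 + 1), d k * ω k) -
        fun ω => ∑ k ∈ Finset.range (n + 1), d k * ω k) = d (n + 1) • fun ω => ω (n + 1) := by
      ext ω
      simp [Finset.sum_range_succ _ (n + 1)]
    rw [h1]
    have h2 := iIndepFun_eval.condExp_natural_ae_eq_of_lt
      (fun n => (measurable_pi_apply n).stronglyMeasurable) (Nat.lt_succ_self n)
    refine (condExp_smul (d (n + 1)) (fun ω : ℕ → ℝ => ω (n + 1)) _).trans ?_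
    filter_upwards [h2] with ω hω
    rw [integral_eval] at hω
    rw [Pi.smul_apply, Pi.zero_apply, smul_eq_mul]
    exact mul_eq_zero_of_right _ hω

/-- The partial sums form a martingale bounded in L², hence in L¹, so martingale convergence
applies. -/
lemma ae_exists_tendsto_sum (hd : Summable fun n => d n ^ 2) :
    ∀ᵐ ω ∂gaussianSequence, ∃ y,
      Tendsto (fun n => ∑ k ∈ Finset.range n, d k * ω k) atTop (𝓝 y) := by
  have hbdd (n : ℕ) : eLpNorm (fun ω : ℕ → ℝ => ∑ k ∈ Finset.range (n + 1), d k * ω k) 1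
      gaussianSequence ≤ ((√(∑' k, d k ^ 2)).toNNReal : ℝ≥0) := by
    have hL := (hasGaussianLaw_sum d (n + 1)).memLp_two
    refine (eLpNorm_le_eLpNorm_of_exponent_le (q := 2) (by norm_num) hL.1).trans ?_
    rw [hL.eLpNorm_eq_integral_rpow_norm (by norm_num) (by norm_num)]
    simp only [ENNReal.toReal_ofNat, Real.rpow_two, Real.norm_eq_abs, sq_abs]
    have h1 : ∫ ω : ℕ → ℝ, (∑ k ∈ Finset.range (n + 1), d k * ω k) ^ 2 ∂gaussianSequence =
        ∑ k ∈ Finset.range (n + 1), d k ^ 2 := by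
      rw [← variance_sum, variance_of_integral_eq_zero hL.1.aemeasurable (integral_sum d _)]
    rw [h1, ENNReal.ofReal]
    norm_cast
    refine Real.toNNReal_le_toNNReal ?_
    rw [← one_div, ← Real.sqrt_eq_rpow]
    exact Real.sqrt_le_sqrt (hd.sum_le_tsum _ fun _ _ => sq_nonneg _)
  filter_upwards [(martingale_sum d).submartingale.exists_ae_tendsto_of_bdd hbdd] with ω hω
  exact hω.imp fun _ => (tendsto_add_atTop_iff_nat 1).1

/-- Characteristic functions of the partial sums converge both to that of the limit, by dominated
convergence, and to the Gaussian one with the limiting variance. -/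
lemma map_of_tendsto_sum {v : ℝ} (hd : HasSum (fun n => d n ^ 2) v) {Y : (ℕ → ℝ) → ℝ}
    (hY : AEMeasurable Y gaussianSequence)
    (hlim : ∀ᵐ ω ∂gaussianSequence,
      Tendsto (fun n => ∑ k ∈ Finset.range n, d k * ω k) atTop (𝓝 (Y ω))) :
    gaussianSequence.map Y = gaussianReal 0 v.toNNReal := by
  have : IsProbabilityMeasure (gaussianSequence.map Y) := Measure.isProbabilityMeasure_map hY
  refine Measure.ext_of_charFun (funext fun t => ?_)
  have h1 : Tendsto (fun n => charFun (gaussianSequence.map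
      (fun ω : ℕ → ℝ => ∑ k ∈ Finset.range n, d k * ω k)) t) atTop
      (𝓝 (charFun (gaussianSequence.map Y) t)) := by
    simp only [charFun_apply_real]
    rw [integral_map hY (by fun_prop)]
    simp_rw [fun n => integral_map (hasGaussianLaw_sum d n).aemeasurable
      (f := fun x : ℝ => Complex.exp (t * x * Complex.I)) (by fun_prop)]
    refine tendsto_integral_of_dominated_convergence (fun _ => 1) (fun n => ?_)
      (by simp) (fun n => ae_of_all _ fun ω => ?_) ?_
    · have hm : Measurable fun ω : ℕ → ℝ => ∑ k ∈ Finset.range n, d k * ω k := by fun_prop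
      exact Measurable.aestronglyMeasurable (by fun_prop)
    · rw [← Complex.ofReal_mul, Complex.norm_exp_ofReal_mul_I]
    · filter_upwards [hlim] with ω hω
      have hc : Continuous fun x : ℝ => Complex.exp (t * x * Complex.I) := by fun_prop
      exact (hc.tendsto _).comp hω
  refine tendsto_nhds_unique h1 ?_
  simp only [map_sum, charFun_gaussianReal]
  have h2 : Tendsto (fun n => ((∑ k ∈ Finset.range n, d k ^ 2).toNNReal : ℝ)) atTop
      (𝓝 (v.toNNReal : ℝ)) :=
    (NNReal.continuous_coe.tendsto _).comp ((continuous_real_toNNReal.tendsto _).comp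
      hd.tendsto_sum_nat)
  have hc : Continuous fun x : ℝ =>
      Complex.exp (t * (0 : ℝ) * Complex.I - (x : ℂ) * t ^ 2 / 2) := by fun_prop
  exact (hc.tendsto _).comp h2

lemma map_linearCombination_of_tendsto_sum {T ι : Type*} [Fintype ι] {k : T → T → ℝ}
    {c : ℕ → T → ℝ} (hk : ∀ s t, HasSum (fun n => c n s * c n t) (k s t))
    {X : T → (ℕ → ℝ) → ℝ} (hX : ∀ t, Measurable (X t))
    (hlim : ∀ t, ∀ᵐ ω ∂gaussianSequence,
      Tendsto (fun n => ∑ j ∈ Finset.range n, c j t * ω j) atTop (𝓝 (X t ω)))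
    (a : ι → ℝ) (t : ι → T) :
    gaussianSequence.map (fun ω => ∑ i, a i * X (t i) ω) =
      gaussianReal 0 (∑ i, ∑ j, a i * a j * k (t i) (t j)).toNNReal := by
  refine map_of_tendsto_sum (d := fun n => ∑ i, a i * c n (t i)) ?_ ?_ ?_
  · have := hasSum_sum (s := Finset.univ) fun i _ => hasSum_sum (s := Finset.univ)
      fun j _ => (hk (t i) (t j)).mul_left (a i * a j)
    have h : (fun n => (∑ i, a i * c n (t i)) ^ 2) =
        fun n => ∑ i, ∑ j, a i * a j * (c n (t i) * c n (t j)) := by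
      ext n
      rw [sq, Finset.sum_mul_sum]
      exact Finset.sum_congr rfl fun i _ => Finset.sum_congr rfl fun j _ => by ring
    rwa [h]
  · exact (Finset.measurable_fun_sum _ fun i _ => (hX (t i)).const_mul (a i)).aemeasurable
  · filter_upwards [ae_all_iff.2 fun i => hlim (t i)] with ω hω
    have := tendsto_finsetSum Finset.univ fun i _ => (hω i).const_mul (a i)
    refine this.congr fun n => ?_
    simp only [Finset.mul_sum, Finset.sum_mul]
    rw [Finset.sum_comm]
    exact Finset.sum_congr rfl fun i _ => Finset.sum_congr rfl fun j _ => by ring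

end gaussianSequence

open gaussianSequence in
/-- A kernel with a countable measurable feature expansion is the covariance of a jointly measurable
Gaussian process. -/
theorem exists_measurable_isZeroMeanGP {T : Type*} [MeasurableSpace T] {k : T → T → ℝ}
    {c : ℕ → T → ℝ} (hc : ∀ n, Measurable (c n))
    (hk : ∀ s t, HasSum (fun n => c n s * c n t) (k s t)) :
    ∃ X : T → (ℕ → ℝ) → ℝ, Measurable (fun p : T × (ℕ → ℝ) => X p.1 p.2) ∧
      IsZeroMeanGP gaussianSequence k X := by
  let S : ℕ → T × (ℕ → ℝ) → ℝ := fun n p => ∑ j ∈ Finset.range n, c j p.1 * p.2 j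
  have hS : ∀ n, Measurable (S n) := fun n => by
    refine Finset.measurable_fun_sum _ fun j _ => ?_
    exact ((hc j).comp measurable_fst).mul ((measurable_pi_apply j).comp measurable_snd)
  -- Setting the process to 0 off the measurable convergence set gives an everywhere pointwise
  -- limit, hence joint measurability; each section of A has full measure.
  let A : Set (T × (ℕ → ℝ)) := {p | ∃ y, Tendsto (fun n => S n p) atTop (𝓝 y)}
  have hA : MeasurableSet A := measurableSet_exists_tendsto hS
  have hlim : ∀ p, ∃ y, Tendsto (fun n => A.indicator (S n) p) atTop (𝓝 y) := fun p => by
    by_cases hp : p ∈ A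
    · simp only [Set.indicator_of_mem hp]
      exact hp
    · exact ⟨0, by simp only [Set.indicator_of_notMem hp, tendsto_const_nhds]⟩
  choose X hX using hlim
  have hXm : Measurable X :=
    measurable_of_tendsto_metrizable (fun n => (hS n).indicator hA) (tendsto_pi_nhds.2 hX)
  have hXt : ∀ t, Measurable fun ω => X (t, ω) := fun t => hXm.comp measurable_prodMk_left
  have hXlim : ∀ t, ∀ᵐ ω ∂gaussianSequence,
      Tendsto (fun n => ∑ j ∈ Finset.range n, c j t * ω j) atTop (𝓝 (X (t, ω))) := fun t => by
    have hs : Summable fun n => c n t ^ 2 := by simpa only [sq] using (hk t t).summable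
    filter_upwards [ae_exists_tendsto_sum hs] with ω hω
    have hp : (t, ω) ∈ A := hω
    simpa only [Set.indicator_of_mem hp] using hX (t, ω)
  have hlaw {ι : Type} [Fintype ι] (a : ι → ℝ) (t : ι → T) :=
    map_linearCombination_of_tendsto_sum hk hXt hXlim a t
  have hgp : IsGaussianProcess (fun t ω => X (t, ω)) gaussianSequence := by
    classical
    refine ⟨fun I => ⟨isGaussian_of_map_eq_gaussianReal fun L => ?_⟩⟩
    rw [Measure.map_map (by fun_prop) (by exact measurable_pi_lambda _ fun i => hXt i)]
    refine ⟨_, _, (Eq.trans ?_ (map_linearCombination_of_tendsto_sum hk hXt hXlim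
      (fun i : I => L (Pi.single i 1)) fun i => i))⟩
    congr 1
    ext ω
    simp only [Function.comp]
    conv_lhs => rw [← Finset.univ_sum_single (I.restrict fun t => X (t, ω)), _root_.map_sum]
    refine Finset.sum_congr rfl fun i _ => ?_
    rw [Finset.restrict, mul_comm, ← smul_eq_mul, ← map_smul]
    congr 1
    ext j
    simp [Pi.single_apply]
  have hvar (s t : T) (a b : ℝ) : Var[fun ω => a * X (s, ω) + b * X (t, ω); gaussianSequence] =
      (a * a * k s s + a * b * k s t + (b * a * k t s + b * b * k t t)).toNNReal := by
    have h := hlaw ![a, b] ![s, t]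
    simp only [Fin.sum_univ_two, Matrix.cons_val_zero, Matrix.cons_val_one] at h
    have hm : Measurable fun ω => a * X (s, ω) + b * X (t, ω) :=
      ((hXt s).const_mul a).add ((hXt t).const_mul b)
    have h2 := variance_map (X := id) aemeasurable_id (μ := gaussianSequence) hm.aemeasurable
    rw [h, variance_id_gaussianReal] at h2
    exact h2.symm
  have hsymm (s t : T) : k s t = k t s := (hk s t).unique (by simpa only [mul_comm] using hk t s)
  have hnonneg (s t : T) (a b : ℝ) :
      0 ≤ a * a * k s s + a * b * k s t + (b * a * k t s + b * b * k t t) := by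
    have := (((hk s s).mul_left (a * a)).add ((hk s t).mul_left (a * b))).add
      (((hk t s).mul_left (b * a)).add ((hk t t).mul_left (b * b)))
    refine this.nonneg fun n => ?_
    have h : 0 ≤ (a * c n s + b * c n t) ^ 2 := sq_nonneg _
    linarith
  refine ⟨fun t ω => X (t, ω), hXm, hgp, hXt, fun t => ?_, fun s t => ?_⟩
  · have h := hlaw (fun _ : Unit => 1) fun _ => t
    simp only [Finset.univ_unique, Finset.sum_singleton, one_mul] at h
    rw [← integral_map (f := fun x => x) (hXt t).aemeasurable (by fun_prop), h,
      integral_id_gaussianReal]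
  · have hL (t : T) : MemLp (fun ω => X (t, ω)) 2 gaussianSequence :=
      (hgp.hasGaussianLaw_eval t).memLp_two
    -- Polarisation: the covariance is recovered from the variances of the sum and of the two
    -- summands.
    have h1 := hvar s t 1 1
    have h2 := hvar s t 1 0
    have h3 := hvar s t 0 1
    rw [Real.coe_toNNReal _ (hnonneg s t _ _)] at h1 h2 h3
    simp only [one_mul, zero_mul, mul_zero, add_zero, zero_add] at h1 h2 h3
    rw [variance_fun_add (hL s) (hL t), h2, h3, hsymm t s] at h1
    linarith

/-! ### Feature expansion of the spectral kernel -/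

/-- The inner product of `L²` features depending measurably on a parameter has a countable
measurable expansion. -/
lemma exists_measurable_hasSum_integral_inner {T B V : Type*} [MeasurableSpace T]
    [MeasurableSpace B] [MeasurableSpace.CountablyGenerated B] (μ : Measure B) [IsFiniteMeasure μ]
    [NormedAddCommGroup V] [InnerProductSpace ℝ V] [CompleteSpace V] [SecondCountableTopology V]
    [MeasurableSpace V] [BorelSpace V] {F : T → B → V}
    (hF : Measurable fun p : T × B => F p.1 p.2) (hL : ∀ t, MemLp (F t) 2 μ) :
    ∃ c : ℕ → T → ℝ, (∀ n, Measurable (c n)) ∧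
      ∀ s t, HasSum (fun n => c n s * c n t) (∫ b, inner ℝ (F s b) (F t b) ∂μ) := by
  obtain ⟨w, b, -⟩ := exists_hilbertBasis ℝ (Lp V 2 μ)
  have hw : Countable w := by
    have : Fact ((2 : ENNReal) ≠ ⊤) := ⟨by simp⟩
    have hb := b.orthonormal
    -- Orthonormal vectors lie √2 apart, so these balls are disjoint, and a separable space holds
    -- only countably many.
    refine Pairwise.countable_of_isOpen_disjoint (s := fun i => Metric.ball (b i) (1 / 2))
      (fun i j hij => ?_) (fun i => Metric.isOpen_ball) fun i => ⟨b i, by simp⟩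
    refine Metric.ball_disjoint_ball ?_
    rw [dist_eq_norm]
    have h : ‖b i - b j‖ ^ 2 = 2 := by
      rw [norm_sub_sq_real, hb.2 hij, hb.1 i, hb.1 j]
      norm_num
    nlinarith [norm_nonneg (b i - b j)]
  have := Encodable.ofCountable w
  let f : w → T → ℝ := fun i t => inner ℝ (b i) (hL t).toLp
  have hf : ∀ i, Measurable (f i) := fun i => by
    have h1 : f i = fun t => ∫ x, inner ℝ (b i x) (F t x) ∂μ := by
      ext t
      simp only [f, L2.inner_def]
      refine integral_congr_ae ?_
      filter_upwards [(hL t).coeFn_toLp] with x hx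
      rw [hx]
    rw [h1]
    refine StronglyMeasurable.measurable (StronglyMeasurable.integral_prod_right'
      (f := fun p : T × B => inner ℝ (b i p.2) (F p.1 p.2)) ?_)
    exact ((Lp.stronglyMeasurable (b i)).comp_measurable measurable_snd).inner hF.stronglyMeasurable
  -- Indices that encode no basis vector get coefficient 0; the sum is then Parseval's identity.
  refine ⟨fun n t => Function.extend Encodable.encode (fun i => f i t) 0 n, fun n => ?_,
    fun s t => ?_⟩
  · by_cases hn : ∃ i : w, Encodable.encode i = n
    · obtain ⟨i, rfl⟩ := hn
      simpa only [Encodable.encode_injective.extend_apply] using hf i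
    · simpa only [Function.extend_apply' _ _ _ hn] using measurable_const
  · rw [← Function.Injective.hasSum_iff (Encodable.encode_injective (α := w))]
    · have h1 : ∫ x, inner ℝ (F s x) (F t x) ∂μ = inner ℝ (hL s).toLp (hL t).toLp := by
        rw [L2.inner_def]
        refine integral_congr_ae ?_
        filter_upwards [(hL s).coeFn_toLp, (hL t).coeFn_toLp] with x hx hx'
        rw [hx, hx']
      rw [h1]
      simp only [Function.comp_def, Encodable.encode_injective.extend_apply]
      refine (b.hasSum_inner_mul_inner (hL s).toLp (hL t).toLp).congr_fun fun i => ?_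
      rw [real_inner_comm]
    · intro n hn
      simp only [Function.extend_apply' _ _ _ hn, Pi.zero_apply, mul_zero]

/-- The feature `β ↦ (cos (√β zⱼ), sin (√β zⱼ))ⱼ / √H` of `z`. -/
noncomputable def spectralFeature (H : ℕ) (z : EuclideanSpace ℝ (Fin H)) (β : ℝ≥0) :
    EuclideanSpace ℝ (Fin H × Bool) :=
  WithLp.toLp 2 fun p => (√H)⁻¹ *
    if p.2 then Real.cos (√(β : ℝ) * z p.1) else Real.sin (√(β : ℝ) * z p.1)

lemma measurable_spectralFeature (H : ℕ) :
    Measurable fun p : EuclideanSpace ℝ (Fin H) × ℝ≥0 => spectralFeature H p.1 p.2 := by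
  refine Continuous.measurable ?_
  unfold spectralFeature
  refine (PiLp.continuous_toLp 2 _).comp (continuous_pi fun q => ?_)
  split_ifs <;> fun_prop

lemma inner_spectralFeature (H : ℕ) (z z' : EuclideanSpace ℝ (Fin H)) (β : ℝ≥0) :
    inner ℝ (spectralFeature H z β) (spectralFeature H z' β) =
      (H : ℝ)⁻¹ * ∑ j, Real.cos (√(β : ℝ) * (z j - z' j)) := by
  simp only [spectralFeature, PiLp.inner_apply, Fintype.sum_prod_type, Fintype.sum_bool,
    Finset.mul_sum]
  refine Finset.sum_congr rfl fun j _ => ?_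
  have h : (√(H : ℝ))⁻¹ * (√(H : ℝ))⁻¹ = (H : ℝ)⁻¹ := by
    rw [← mul_inv, Real.mul_self_sqrt (Nat.cast_nonneg H)]
  rw [mul_sub, Real.cos_sub, ← h]
  simp
  ring

lemma memLp_spectralFeature (μ : Measure ℝ≥0) [IsFiniteMeasure μ] (H : ℕ)
    (z : EuclideanSpace ℝ (Fin H)) : MemLp (spectralFeature H z) 2 μ := by
  have hm : Measurable fun β : ℝ≥0 => spectralFeature H z β := by
    have h1 : Measurable fun β : ℝ≥0 => (z, β) := measurable_prodMk_left
    have h2 := measurable_spectralFeature H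
    fun_prop
  refine MemLp.of_bound hm.aestronglyMeasurable (√((H : ℝ)⁻¹ * H)) (ae_of_all _ fun β => ?_)
  rw [norm_eq_sqrt_real_inner, inner_spectralFeature]
  simp

lemma integrable_cos_sqrt_mul (μ : Measure ℝ≥0) [IsFiniteMeasure μ] (a : ℝ) :
    Integrable (fun β : ℝ≥0 => Real.cos (√(β : ℝ) * a)) μ :=
  Integrable.of_bound (C := 1) (by fun_prop) (ae_of_all _ fun _ => Real.abs_cos_le_one _)

lemma integral_inner_spectralFeature (μ : Measure ℝ≥0) [IsFiniteMeasure μ] (H : ℕ)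
    (z z' : EuclideanSpace ℝ (Fin H)) :
    ∫ β, inner ℝ (spectralFeature H z β) (spectralFeature H z' β) ∂μ =
      additiveSpectralKernel μ H z z' := by
  simp only [inner_spectralFeature, additiveSpectralKernel]
  rw [integral_const_mul, integral_finsetSum _ fun j _ => integrable_cos_sqrt_mul μ _]

theorem exists_isZeroMeanGP_additiveSpectralKernel (μ : Measure ℝ≥0) [IsFiniteMeasure μ] (H : ℕ) :
    ∃ X : EuclideanSpace ℝ (Fin H) → (ℕ → ℝ) → ℝ,
      Measurable (fun p : EuclideanSpace ℝ (Fin H) × (ℕ → ℝ) => X p.1 p.2) ∧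
      IsZeroMeanGP gaussianSequence (additiveSpectralKernel μ H) X := by
  obtain ⟨c, hc, hk⟩ := exists_measurable_hasSum_integral_inner μ (measurable_spectralFeature H)
    (memLp_spectralFeature μ H)
  simp only [integral_inner_spectralFeature] at hk
  exact exists_measurable_isZeroMeanGP hc hk

/-! ### The linear layer and the composition -/

/-- The linear layer: independent standard Gaussian weight vectors, one for each coordinate. -/
noncomputable def linearLayerMeasure (D H : ℕ) : Measure (Fin H → EuclideanSpace ℝ (Fin D)) :=
  Measure.pi fun _ => stdGaussian (EuclideanSpace ℝ (Fin D))

instance (D H : ℕ) : IsProbabilityMeasure (linearLayerMeasure D H) :=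
  inferInstanceAs (IsProbabilityMeasure (Measure.pi fun _ => _))

lemma map_eval_linearLayerMeasure (D H : ℕ) (j : Fin H) :
    (linearLayerMeasure D H).map (fun W => W j) = stdGaussian (EuclideanSpace ℝ (Fin D)) :=
  (measurePreserving_eval _ j).map_eq

lemma isGaussianProcess_inner_stdGaussian (E : Type*) [NormedAddCommGroup E]
    [InnerProductSpace ℝ E] [FiniteDimensional ℝ E] [MeasurableSpace E] [BorelSpace E] :
    IsGaussianProcess (fun (x : E) (w : E) => inner ℝ x w) (stdGaussian E) where
  hasGaussianLaw I := (IsGaussian.hasGaussianLaw_id (μ := stdGaussian E)).map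
    (ContinuousLinearMap.pi fun i : I => innerSL ℝ (i : E))

lemma isZeroMeanGP_inner_stdGaussian (D : ℕ) :
    IsZeroMeanGP (stdGaussian (EuclideanSpace ℝ (Fin D))) (linearKernel D)
      (fun x w => inner ℝ x w) where
  isGaussianProcess := isGaussianProcess_inner_stdGaussian _
  measurable x := by fun_prop
  mean_eq_zero x := integral_strongDual_stdGaussian (innerSL ℝ x)
  covariance_eq s t := by
    have h := covarianceBilin_stdGaussian (E := EuclideanSpace ℝ (Fin D))
    have h2 := covarianceBilin_apply_eq_cov (μ := stdGaussian (EuclideanSpace ℝ (Fin D)))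
      IsGaussian.memLp_two_id s t
    rw [h] at h2
    exact h2.symm

lemma IsZeroMeanGP.comp {Ω Ω' T : Type*} [MeasurableSpace Ω] [MeasurableSpace Ω']
    {P : Measure Ω} {P' : Measure Ω'} {k : T → T → ℝ} {X : T → Ω' → ℝ}
    (hX : IsZeroMeanGP P' k X) {f : Ω → Ω'} (hf : MeasurePreserving f P P') :
    IsZeroMeanGP P k (fun t ω => X t (f ω)) where
  isGaussianProcess := ⟨fun I => ⟨by
    have h := (hX.isGaussianProcess.hasGaussianLaw I).isGaussian_map
    rw [← hf.map_eq, Measure.map_map (by exact measurable_pi_lambda _ fun i => hX.measurable i)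
      hf.measurable] at h
    exact h⟩⟩
  measurable t := (hX.measurable t).comp hf.measurable
  mean_eq_zero t := by
    rw [← hX.mean_eq_zero t, ← hf.map_eq, integral_map hf.measurable.aemeasurable
      (hX.measurable t).aestronglyMeasurable]
  covariance_eq s t := by
    rw [← hX.covariance_eq s t, ← hf.map_eq, covariance_map]
    · rfl
    · exact (hX.measurable s).aestronglyMeasurable
    · exact (hX.measurable t).aestronglyMeasurable
    · exact hf.measurable.aemeasurable

/-- This is the real part of the characteristic function. -/
lemma integral_cos_inner_stdGaussian {E : Type*} [NormedAddCommGroup E] [InnerProductSpace ℝ E]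
    [FiniteDimensional ℝ E] [MeasurableSpace E] [BorelSpace E] (v : E) :
    ∫ w, Real.cos (inner ℝ v w) ∂(stdGaussian E) = Real.exp (-‖v‖ ^ 2 / 2) := by
  have h := congrArg Complex.re (charFun_stdGaussian v)
  rw [charFun_apply, ← RCLike.re_eq_complex_re, ← integral_re] at h
  · have h2 : ∀ w : E, RCLike.re (Complex.exp (inner ℝ w v * Complex.I)) =
        Real.cos (inner ℝ v w) := fun w => by
      rw [real_inner_comm, RCLike.re_eq_complex_re, Complex.exp_ofReal_mul_I_re]
    simp only [h2] at h
    rw [h, RCLike.re_eq_complex_re, ← Complex.exp_ofReal_re]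
    push_cast
    rfl
  · refine Integrable.of_bound (C := 1) (Continuous.aestronglyMeasurable (by fun_prop))
      (ae_of_all _ fun w => ?_)
    rw [Complex.norm_exp_ofReal_mul_I]

section Construction

variable {D H : ℕ}

/-- The point of `ℝ^H` to which the linear layer with weights `W` maps `x`. -/
noncomputable def linearLayer (W : Fin H → EuclideanSpace ℝ (Fin D))
    (x : EuclideanSpace ℝ (Fin D)) : EuclideanSpace ℝ (Fin H) :=
  WithLp.toLp 2 fun j => inner ℝ x (W j)

lemma measurable_linearLayer (x : EuclideanSpace ℝ (Fin D)) :
    Measurable fun W : Fin H → EuclideanSpace ℝ (Fin D) => linearLayer W x := by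
  refine Continuous.measurable ?_
  unfold linearLayer
  fun_prop

/-- The weights of both layers. -/
noncomputable def layersMeasure (D H : ℕ) :
    Measure ((Fin H → EuclideanSpace ℝ (Fin D)) × (ℕ → ℝ)) :=
  (linearLayerMeasure D H).prod gaussianSequence

instance : IsProbabilityMeasure (layersMeasure D H) :=
  inferInstanceAs (IsProbabilityMeasure (Measure.prod _ _))

lemma measurePreserving_weights (j : Fin H) :
    MeasurePreserving (fun ω => ω.1 j) (layersMeasure D H) (stdGaussian _) :=
  (measurePreserving_eval _ j).comp measurePreserving_fst

lemma iIndepFun_weights : iIndepFun (fun (j : Fin H) ω => ω.1 j) (layersMeasure D H) := by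
  rw [iIndepFun_iff_map_fun_eq_pi_map fun j => (measurePreserving_weights j).measurable.aemeasurable]
  simp only [(measurePreserving_weights _).map_eq]
  exact measurePreserving_fst.map_eq

lemma isTwoLayerDeepGP_layersMeasure {k₂ : EuclideanSpace ℝ (Fin H) → EuclideanSpace ℝ (Fin H) → ℝ}
    {X : EuclideanSpace ℝ (Fin H) → (ℕ → ℝ) → ℝ}
    (hX : Measurable fun p : EuclideanSpace ℝ (Fin H) × (ℕ → ℝ) => X p.1 p.2)
    (hGP : IsZeroMeanGP gaussianSequence k₂ X) :
    IsTwoLayerDeepGP (layersMeasure D H) (linearKernel D) k₂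
      (fun j x ω => inner ℝ x (ω.1 j)) (fun z ω => X z ω.2) where
  isProbabilityMeasure := inferInstance
  first_layer j := (isZeroMeanGP_inner_stdGaussian D).comp (measurePreserving_weights j)
  first_layer_indep := iIndepFun_weights.comp (fun _ w x => inner ℝ x w) fun _ =>
    measurable_pi_lambda _ fun x => by fun_prop
  second_layer := hGP.comp measurePreserving_snd
  layers_indep := by
    refine ⟨MeasurableSpace.comap Prod.snd inferInstance, measurable_snd.comap_le, ?_, ?_⟩
    · refine @Measurable.comp _ _ _ (_) _ _ (fun p : EuclideanSpace ℝ (Fin H) × (ℕ → ℝ) => X p.1 p.2)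
        (fun p : EuclideanSpace ℝ (Fin H) × (Fin H → EuclideanSpace ℝ (Fin D)) × (ℕ → ℝ) =>
          (p.1, p.2.2)) hX ?_
      exact @Measurable.prodMk _ _ _ _ _ (_) _ _ (@measurable_fst _ _ _ (_))
        (@Measurable.comp _ _ _ (_) (_) _ _ _ (comap_measurable _) (@measurable_snd _ _ _ (_)))
    · have h := (IndepFun_iff_Indep _ _ _).1 (indepFun_prod (μ := linearLayerMeasure D H)
        (ν := gaussianSequence) measurable_id measurable_id)
      refine indep_of_indep_of_le_left h ?_
      refine iSup_le fun j => iSup_le fun x => ?_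
      refine Measurable.comap_le ?_
      have hm : Measurable fun W : Fin H → EuclideanSpace ℝ (Fin D) => inner ℝ x (W j) := by
        fun_prop
      exact hm.comp (comap_measurable _)

variable {k₂ : EuclideanSpace ℝ (Fin H) → EuclideanSpace ℝ (Fin H) → ℝ}
  {X : EuclideanSpace ℝ (Fin H) → (ℕ → ℝ) → ℝ}

lemma measurable_comp_linearLayer
    (hX : Measurable fun p : EuclideanSpace ℝ (Fin H) × (ℕ → ℝ) => X p.1 p.2)
    (x : EuclideanSpace ℝ (Fin D)) :
    Measurable fun ω : (Fin H → EuclideanSpace ℝ (Fin D)) × (ℕ → ℝ) =>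
      X (linearLayer ω.1 x) ω.2 :=
  hX.comp (((measurable_linearLayer x).comp measurable_fst).prodMk measurable_snd)

lemma IsZeroMeanGP.memLp_two {Ω T : Type*} [MeasurableSpace Ω] {P : Measure Ω} {k : T → T → ℝ}
    {Y : T → Ω → ℝ} (hY : IsZeroMeanGP P k Y) (t : T) : MemLp (Y t) 2 P :=
  (hY.isGaussianProcess.hasGaussianLaw_eval t).memLp_two

lemma IsZeroMeanGP.integral_mul {Ω T : Type*} [MeasurableSpace Ω] {P : Measure Ω} {k : T → T → ℝ}
    {Y : T → Ω → ℝ} (hY : IsZeroMeanGP P k Y) (s t : T) : ∫ ω, Y s ω * Y t ω ∂P = k s t := by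
  rw [← hY.covariance_eq s t, covariance, hY.mean_eq_zero, hY.mean_eq_zero]
  simp

/-- Given the first-layer weights, the second moment is k₂ on the diagonal; its constancy makes it
integrable over the weights. -/
lemma memLp_two_comp_linearLayer
    (hX : Measurable fun p : EuclideanSpace ℝ (Fin H) × (ℕ → ℝ) => X p.1 p.2)
    (hGP : IsZeroMeanGP gaussianSequence k₂ X) {v : ℝ} (hv : ∀ z, k₂ z z = v)
    (x : EuclideanSpace ℝ (Fin D)) :
    MemLp (fun ω => X (linearLayer ω.1 x) ω.2) 2 (layersMeasure D H) := by
  have hm := measurable_comp_linearLayer hX x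
  rw [memLp_two_iff_integrable_sq hm.aestronglyMeasurable, layersMeasure,
    integrable_prod_iff (hm.pow_const 2).aestronglyMeasurable]
  refine ⟨ae_of_all _ fun W => (hGP.memLp_two (linearLayer W x)).integrable_sq, ?_⟩
  refine (integrable_const v).congr (ae_of_all _ fun W => ?_)
  simp only [Real.norm_eq_abs, abs_sq]
  simp only [sq, hGP.integral_mul, hv]

lemma integral_mul_comp_linearLayer
    (hX : Measurable fun p : EuclideanSpace ℝ (Fin H) × (ℕ → ℝ) => X p.1 p.2)
    (hGP : IsZeroMeanGP gaussianSequence k₂ X) {v : ℝ} (hv : ∀ z, k₂ z z = v)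
    (x x' : EuclideanSpace ℝ (Fin D)) :
    ∫ ω, X (linearLayer ω.1 x) ω.2 * X (linearLayer ω.1 x') ω.2 ∂(layersMeasure D H) =
      ∫ W, k₂ (linearLayer W x) (linearLayer W x') ∂(linearLayerMeasure D H) := by
  have h := (memLp_two_comp_linearLayer hX hGP hv x).integrable_mul
    (memLp_two_comp_linearLayer hX hGP hv x')
  rw [layersMeasure] at h ⊢
  refine (integral_prod _ h).trans ?_
  simp only [Pi.mul_apply, hGP.integral_mul]

lemma integral_comp_linearLayer
    (hX : Measurable fun p : EuclideanSpace ℝ (Fin H) × (ℕ → ℝ) => X p.1 p.2)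
    (hGP : IsZeroMeanGP gaussianSequence k₂ X) {v : ℝ} (hv : ∀ z, k₂ z z = v)
    (x : EuclideanSpace ℝ (Fin D)) :
    ∫ ω, X (linearLayer ω.1 x) ω.2 ∂(layersMeasure D H) = 0 := by
  have h := (memLp_two_comp_linearLayer hX hGP hv x).integrable (by norm_num)
  rw [layersMeasure] at h ⊢
  rw [integral_prod _ h]
  simp only [hGP.mean_eq_zero, integral_zero]

/-- After Fubini, every coordinate contributes the same Gaussian average of a cosine, so the factor
1 / H cancels the sum and the width disappears. -/
lemma integral_additiveSpectralKernel_linearLayer (μ : Measure ℝ≥0) [IsFiniteMeasure μ]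
    (hH : 1 ≤ H) (x x' : EuclideanSpace ℝ (Fin D)) :
    ∫ W, additiveSpectralKernel μ H (linearLayer W x) (linearLayer W x') ∂(linearLayerMeasure D H) =
      ∫ β : ℝ≥0, Real.exp (-(1 / 2) * ‖x - x'‖ ^ 2 * (β : ℝ)) ∂μ := by
  have hint (j : Fin H) : Integrable (Function.uncurry
      fun (W : Fin H → EuclideanSpace ℝ (Fin D)) (β : ℝ≥0) =>
        Real.cos (√(β : ℝ) * inner ℝ (x - x') (W j))) ((linearLayerMeasure D H).prod μ) := by
    refine Integrable.of_bound (C := 1) (Continuous.aestronglyMeasurable ?_)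
      (ae_of_all _ fun _ => Real.abs_cos_le_one _)
    simp only [Function.uncurry_def]
    fun_prop
  have hj (j : Fin H) : ∫ W : Fin H → EuclideanSpace ℝ (Fin D), ∫ β : ℝ≥0,
      Real.cos (√(β : ℝ) * inner ℝ (x - x') (W j)) ∂μ ∂(linearLayerMeasure D H) =
        ∫ β : ℝ≥0, Real.exp (-(1 / 2) * ‖x - x'‖ ^ 2 * (β : ℝ)) ∂μ := by
    rw [integral_integral_swap (hint j)]
    refine integral_congr_ae (ae_of_all _ fun β => ?_)
    have h1 := integral_cos_inner_stdGaussian (√(β : ℝ) • (x - x'))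
    rw [← map_eval_linearLayerMeasure D H j,
      integral_map (measurable_pi_apply j).aemeasurable
      (Continuous.aestronglyMeasurable (by fun_prop))] at h1
    simp only [real_inner_smul_left] at h1
    simp only [h1, norm_smul, mul_pow, Real.norm_eq_abs, sq_abs,
      Real.sq_sqrt (NNReal.coe_nonneg β)]
    congr 1
    ring
  have h0 : (H : ℝ) ≠ 0 := by positivity
  have hint' (j : Fin H) : Integrable (fun W : Fin H → EuclideanSpace ℝ (Fin D) => ∫ β : ℝ≥0,
      Real.cos (√(β : ℝ) * inner ℝ (x - x') (W j)) ∂μ) (linearLayerMeasure D H) :=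
    (hint j).integral_prod_left
  simp only [additiveSpectralKernel, linearLayer, ← inner_sub_left]
  rw [integral_const_mul, integral_finsetSum _ fun j _ => hint' j]
  simp [hj, h0]

end Construction

theorem mainTheorem6 (φ : ℝ → ℝ)
    (hcov : ∀ D : ℕ, IsCovarianceFunction (isotropicKernel φ D))
    (hcont : ∀ D : ℕ, IsMeanSquareContinuous (isotropicKernel φ D)) :
    ∃ μ : Measure ℝ≥0, IsFiniteMeasure μ ∧
      (∀ r : ℝ, 0 ≤ r → φ r = ∫ β : ℝ≥0, Real.exp (-(1 / 2) * r * (β : ℝ)) ∂μ) ∧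
      ∀ D H : ℕ, 1 ≤ H →
        ∃ (Ω : Type) (_ : MeasurableSpace Ω) (P : Measure Ω)
          (f₁ : Fin H → EuclideanSpace ℝ (Fin D) → Ω → ℝ)
          (f₂ : EuclideanSpace ℝ (Fin H) → Ω → ℝ),
          IsTwoLayerDeepGP P (linearKernel D) (additiveSpectralKernel μ H) f₁ f₂ ∧
          (∀ x, MemLp (composeLayers f₁ f₂ x) 2 P) ∧
          (∀ x, ∫ ω, composeLayers f₁ f₂ x ω ∂P = 0) ∧
          ∀ x x', ∫ ω, composeLayers f₁ f₂ x ω * composeLayers f₁ f₂ x' ω ∂P =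
            isotropicKernel φ D x x' := by
  obtain ⟨μ, hμ, hφ⟩ := exists_laplace_of_isotropicKernel hcov (hcont 1)
  refine ⟨μ, hμ, hφ, fun D H hH => ?_⟩
  obtain ⟨X, hX, hGP⟩ := exists_isZeroMeanGP_additiveSpectralKernel μ H
  have hv : ∀ z, additiveSpectralKernel μ H z z = (H : ℝ)⁻¹ * (H * μ.real Set.univ) := fun z => by
    simp [additiveSpectralKernel]
  refine ⟨_, _, layersMeasure D H, fun j x ω => inner ℝ x (ω.1 j), fun z ω => X z ω.2,
    isTwoLayerDeepGP_layersMeasure hX hGP, memLp_two_comp_linearLayer hX hGP hv,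
    integral_comp_linearLayer hX hGP hv, fun x x' => ?_⟩
  rw [isotropicKernel, hφ _ (by positivity), ← integral_additiveSpectralKernel_linearLayer μ hH x x']
  exact integral_mul_comp_linearLayer hX hGP hv x x'
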